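/- Let $\mathcal T$ be a finite rooted tree with root $r$ of depth at least $1$, let $D$ be its depth (or any upper bound on its depth), and suppose that each vertex $v\neq r$ is computed from its parent in a known number $t_v\ge 1$ of steps; put $t_r=0$ and $T=\sum_v t_v^2$. Some (possibly none) of the leaves of $\mathcal T$ are marked. The expanded tree $\mathcal E$ has the root $r$ and vertices $s(v,1),\dots,s(v,t_v)$ for each $v\ne r$, where $s(v,t)$ is the parent of $s(v,t+1)$, and the parent of $s(v,1)$ is $s(u,t_u)$ if the parent $u$ of $v$ is not the root, and $r$ otherwise; $s(v,t_v)$ is marked iff $v$ is. Give the root of $\mathcal E$ the weight $w_r=1/D$ and $s(v,t)$ the weight $t_v$. For a vertex $x$ of $\mathcal E$ let $\mathcal H_x$ be the span of $|x\rangle$ and of $|y\rangle$ for the children $y$ of $x$, and let $D_x$ act on $\mathcal H_x$ as $I$ if $x$ is marked and as $I-2|\psi_x\rangle\langle\psi_x|$ otherwise, where $|\psi_x\rangle$ is the unit vector proportional to $\sqrt{w_x}\,|x\rangle+\sum_{y\text{ child of }x}\sqrt{w_y}\,|y\rangle$. Let $U=R_BR_A$, where $R_A$ is the direct sum of the $D_x$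 over all $x$ at even distance from the root, and $R_B$ is the direct sum of $|r\rangle\langle r|$ and of the $D_x$ over all $x$ at odd distance from the root. Then $U$ is unitary, and there are universal constants $c,C>0$ and $k\in\mathbb N$, independent of the tree, such that the following holds with $\varepsilon=c/\sqrt{TD}$. Run the phase estimation circuit (Hadamard gates on $s$ phase qubits, controlled powers of $U$, inverse quantum Fourier transform) with $s=\lceil\log_2\lceil 1/\varepsilon\rceil\rceil+3$ on $U$ and the state $|r\rangle$, and accept iff the measured phase value is $0^s$. If there is a marked vertex, a run accepts with probability at least $1/2$; if there is none, a run accepts with probability at most $1/4$. Repeating the procedure $k$ times independently and answering that a marked vertex exists iff at least a $3/8$ fraction of the runs accept is correct with probability at least $2/3$. In total, these $k$ runs use at most $C\sqrt{TD}$ (controlled) applications of $U$. -/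

import Mathlib

/-! ### Rooted trees and computation trees -/

/-- A rooted tree with vertex set `V`, presented by its parent map. The parent map fixes the root
(which has no actual parent), and every vertex is sent to the root by iterating it. -/
structure ParentTree (V : Type*) where
  root : V
  parent : V → V
  parent_root : parent root = root
  reaches_root : ∀ v, ∃ k : ℕ, parent^[k] v = root

namespace ParentTree

variable {V : Type*} (P : ParentTree V)

/-- `P.IsChild u v`: the vertex `v` is a child of the vertex `u`. -/
def IsChild (u v : V) : Prop := v ≠ P.root ∧ P.parent v = u

open Classical in
/-- The distance of a vertex from the root. -/
noncomputable def level (v : V) : ℕ := Nat.find (P.reaches_root v)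

/-- The depth of a finite rooted tree: the largest distance of a vertex from the root. -/
noncomputable def depth [Fintype V] : ℕ := Finset.univ.sup P.level

end ParentTree

/-- The parent map of a rooted tree given as a partial order with the root `⊥` as its least
element, in which the parent of a vertex is its predecessor. -/
def RootedTree.toParentTree (G : RootedTree) : ParentTree G where
  root := ⊥
  parent := Order.pred
  parent_root := Order.pred_bot
  reaches_root _ := IsPredArchimedean.exists_pred_iterate_of_le bot_le

/-- The data of a computation tree on a rooted tree `G`: the vertex `v` is computed from its
parent in `time v` steps, and some of the leaves are marked. -/
structure ComputationTree (G : RootedTree) where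
  time : G → ℕ
  time_root : time ⊥ = 0
  time_pos : ∀ v, v ≠ ⊥ → 0 < time v
  Marked : G → Prop
  marked_isLeaf : ∀ v, Marked v → ∀ u, ¬ v ⋖ u

namespace ComputationTree

variable {G : RootedTree} (𝒯 : ComputationTree G)

/-- `T`, the sum of the squares of the computation times. -/
def sqTime [Fintype G] : ℕ := ∑ v, 𝒯.time v ^ 2

/-! ### The expanded tree -/

/-- Vertices of the expanded tree: `none` is the root `r`, and `some ⟨v, i⟩` is the vertex
`s(v, i + 1)` reached after `i + 1` of the `time v` steps that compute `v`. There are no such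
vertices for `v` the root, because its time is `0`. -/
abbrev ExpVertex : Type _ := Option ((v : G) × Fin (𝒯.time v))

/-- The vertex of the expanded tree where the computation of `v` is complete: `s(v, t_v)` if `v` is
not the root, and `r` if `v` is the root. -/
def endpoint (v : G) : 𝒯.ExpVertex :=
  if h : 0 < 𝒯.time v then some ⟨v, ⟨𝒯.time v - 1, Nat.sub_lt h Nat.one_pos⟩⟩ else none

/-- The parent map of the expanded tree: `s(v, t + 1) ↦ s(v, t)` for `t ≥ 1`, and `s(v, 1)` is
sent to the endpoint of the parent of `v`. -/
def expParent : 𝒯.ExpVertex → 𝒯.ExpVertex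
  | none => none
  | some ⟨v, ⟨0, _⟩⟩ => 𝒯.endpoint (Order.pred v)
  | some ⟨v, ⟨i + 1, h⟩⟩ => some ⟨v, ⟨i, Nat.lt_of_succ_lt h⟩⟩

theorem endpoint_root : 𝒯.endpoint ⊥ = none := by
  simp [endpoint, 𝒯.time_root]

theorem expParent_descend (v : G) (i : ℕ) (h : i < 𝒯.time v) :
    𝒯.expParent^[i + 1] (some ⟨v, ⟨i, h⟩⟩) = 𝒯.endpoint (Order.pred v) := by
  induction i with
  | zero => rfl
  | succ i ih => exact ih (Nat.lt_of_succ_lt h)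

theorem expParent_endpoint (k : ℕ) (v : G) (hk : Order.pred^[k] v = ⊥) :
    ∃ m : ℕ, 𝒯.expParent^[m] (𝒯.endpoint v) = none := by
  induction k generalizing v with
  | zero => exact ⟨0, by simpa [show v = ⊥ from hk] using 𝒯.endpoint_root⟩
  | succ k ih =>
    by_cases h : 0 < 𝒯.time v
    · obtain ⟨m, hm⟩ := ih (Order.pred v) hk
      refine ⟨m + (𝒯.time v - 1 + 1), ?_⟩
      rw [Function.iterate_add_apply, endpoint, dif_pos h, expParent_descend, hm]
    · exact ⟨0, by simp [endpoint, h]⟩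

theorem expParent_reaches (x : 𝒯.ExpVertex) : ∃ m : ℕ, 𝒯.expParent^[m] x = none := by
  rcases x with _ | ⟨v, i, h⟩
  · exact ⟨0, rfl⟩
  · obtain ⟨k, hk⟩ := G.toParentTree.reaches_root (Order.pred v)
    obtain ⟨m, hm⟩ := 𝒯.expParent_endpoint k _ hk
    exact ⟨m + (i + 1), by rw [Function.iterate_add_apply, expParent_descend, hm]⟩

/-- The expanded tree: on the edge above each vertex `v`, `time v - 1` intermediate vertices are
inserted. -/
def expanded : ParentTree 𝒯.ExpVertex where
  root := none
  parent := 𝒯.expParent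
  parent_root := rfl
  reaches_root := 𝒯.expParent_reaches

/-- The marked vertices of the expanded tree are the endpoints of the marked vertices. -/
def ExpMarked (x : 𝒯.ExpVertex) : Prop := ∃ v, 𝒯.Marked v ∧ x = 𝒯.endpoint v

/-! ### The quantum walk

Operators on the space with orthonormal basis `|x⟩`, for `x` in the expanded tree, are given by
their matrices. The number `D` is the depth, or an upper bound on it. -/

/-- The weights: `1 / D` for the root and `t_v` for `s(v, t)`. -/
noncomputable def weight (D : ℕ) : 𝒯.ExpVertex → ℝ
  | none => 1 / (D : ℝ)
  | some x => (𝒯.time x.1 : ℝ)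

variable [Fintype G]

open Classical in
/-- The set consisting of `x` and its children, whose basis vectors span the subspace `H_x`. -/
noncomputable def block (x : 𝒯.ExpVertex) : Finset 𝒯.ExpVertex :=
  Finset.univ.filter fun y => y = x ∨ 𝒯.expanded.IsChild x y

open Classical in
/-- The unit vector `ψ_x` proportional to the sum of `√w_y |y⟩` over `x` and its children `y`. -/
noncomputable def psi (D : ℕ) (x : 𝒯.ExpVertex) : 𝒯.ExpVertex → ℂ := fun y =>
  if y ∈ 𝒯.block x then
    ((√(𝒯.weight D y) / √(∑ z ∈ 𝒯.block x, 𝒯.weight D z) : ℝ) : ℂ)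
  else 0

open Classical in
/-- The orthogonal projection onto `H_x`. -/
noncomputable def blockProj (x : 𝒯.ExpVertex) : Matrix 𝒯.ExpVertex 𝒯.ExpVertex ℂ :=
  Matrix.diagonal fun y => if y ∈ 𝒯.block x then 1 else 0

open Classical in
/-- The diffusion `D_x` as a summand of a direct sum: it is the identity of `H_x` for `x` marked and
`1 - 2 |ψ_x⟩⟨ψ_x|` on `H_x` otherwise, and it is extended by zero to the complement of `H_x`. -/
noncomputable def diffusion (D : ℕ) (x : 𝒯.ExpVertex) : Matrix 𝒯.ExpVertex 𝒯.ExpVertex ℂ :=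
  if 𝒯.ExpMarked x then 𝒯.blockProj x
  else 𝒯.blockProj x -
    (2 : ℂ) • Matrix.vecMulVec (𝒯.psi D x) (star (𝒯.psi D x))

open Classical in
/-- `R_A`: the direct sum of the diffusions at the vertices at even distance from the root. -/
noncomputable def reflA (D : ℕ) : Matrix 𝒯.ExpVertex 𝒯.ExpVertex ℂ :=
  ∑ x ∈ Finset.univ.filter (fun x => Even (𝒯.expanded.level x)), 𝒯.diffusion D x

open Classical in
/-- `R_B`: the direct sum of `|r⟩⟨r|` and of the diffusions at the vertices at odd distance from
the root. -/
noncomputable def reflB (D : ℕ) : Matrix 𝒯.ExpVertex 𝒯.ExpVertex ℂ :=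
  Matrix.single none none 1 +
    ∑ x ∈ Finset.univ.filter (fun x => Odd (𝒯.expanded.level x)), 𝒯.diffusion D x

open Classical in
/-- One step `U = R_B R_A` of the quantum walk. -/
noncomputable def walk (D : ℕ) : Matrix 𝒯.ExpVertex 𝒯.ExpVertex ℂ :=
  𝒯.reflB D * 𝒯.reflA D

end ComputationTree

/-! ### Phase estimation

A circuit acts on a system register with basis `X`, on which `U` acts, and on `s` phase qubits. A
state is the vector of its amplitudes. -/

namespace PhaseEstimation

/-- The gates of the circuit. -/
inductive Gate (s : ℕ) where
  /-- A Hadamard gate on the phase qubit `i`. -/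
  | hadamard (i : Fin s) : Gate s
  /-- One application of `U` to the system register, controlled on the phase qubit `i`. -/
  | controlledU (i : Fin s) : Gate s
  /-- The inverse quantum Fourier transform of the phase register. -/
  | inverseQFT : Gate s

/-- The number whose binary digits are `b`, with the least significant digit first. -/
def val {s : ℕ} (b : Fin s → Bool) : ℕ := ∑ i, if b i then 2 ^ (i : ℕ) else 0

/-- The action of a gate on the states. -/
noncomputable def Gate.apply {X : Type*} [Fintype X] (U : Matrix X X ℂ) {s : ℕ} :
    Gate s → (X × (Fin s → Bool) → ℂ) → (X × (Fin s → Bool) → ℂ)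
  | .hadamard i, φ => fun p =>
      (φ (p.1, Function.update p.2 i false) +
        (if p.2 i then -1 else 1) * φ (p.1, Function.update p.2 i true)) / (√2 : ℝ)
  | .controlledU i, φ => fun p =>
      if p.2 i then ∑ y, U p.1 y * φ (y, p.2) else φ p
  | .inverseQFT, φ => fun p =>
      (∑ b : Fin s → Bool,
        Complex.exp (-(2 * Real.pi * Complex.I * val p.2 * val b / 2 ^ s)) * φ (p.1, b)) /
        (√(2 ^ s) : ℝ)

/-- Run a list of gates, the head of the list first. -/
noncomputable def run {X : Type*} [Fintype X] (U : Matrix X X ℂ) {s : ℕ}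
    (gates : List (Gate s)) (φ : X × (Fin s → Bool) → ℂ) : X × (Fin s → Bool) → ℂ :=
  gates.foldl (fun χ g => g.apply U χ) φ

/-- The number of applications of `U` made by a single gate. -/
def Gate.uses {s : ℕ} : Gate s → ℕ
  | .controlledU _ => 1
  | _ => 0

/-- The number of applications of `U` made by a circuit. -/
def uses {s : ℕ} (gates : List (Gate s)) : ℕ := (gates.map Gate.uses).sum

/-- The phase estimation circuit with `s` phase qubits: Hadamard gates on all phase qubits,
then `U ^ (2 ^ i)` controlled on the phase qubit `i` for each `i`, then the inverse quantum Fourier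
transform. -/
def circuit (s : ℕ) : List (Gate s) :=
  (List.finRange s).map Gate.hadamard ++
    (List.finRange s).flatMap (fun i : Fin s => List.replicate (2 ^ (i : ℕ)) (Gate.controlledU i)) ++
    [Gate.inverseQFT]

/-- The number of phase qubits used for precision `ε`: the phase register then has between `8 / ε`
and a constant multiple of `1 / ε + 1` values. -/
noncomputable def qubits (ε : ℝ) : ℕ := Nat.clog 2 ⌈1 / ε⌉₊ + 3

open Classical in
/-- The initial state: `|x₀⟩` in the system register and `|0 … 0⟩` in the phase register. -/
noncomputable def initial {X : Type*} (x₀ : X) (s : ℕ) : X × (Fin s → Bool) → ℂ :=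
  Pi.single (x₀, fun _ => false) 1

/-- The probability (by Born's rule) that phase estimation of `U` with precision `ε`, started in
`|x₀⟩`, yields the value `b` when the phase register is measured at the end. -/
noncomputable def outcomeProb {X : Type*} [Fintype X] (U : Matrix X X ℂ) (x₀ : X) (ε : ℝ)
    (b : Fin (qubits ε) → Bool) : ℝ :=
  ∑ x, ‖run U (circuit (qubits ε)) (initial x₀ (qubits ε)) (x, b)‖ ^ 2

end PhaseEstimation

/-! ### The detection algorithm -/

namespace ComputationTree

variable {G : RootedTree} [Fintype G] (𝒯 : ComputationTree G)

open PhaseEstimation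

/-- The acceptance probability of a single run: phase estimation with precision `ε` on `U` and
`|r⟩`, accepting if and only if the measured phase value is `0 … 0`. -/
noncomputable def acceptProb (D : ℕ) (ε : ℝ) : ℝ :=
  outcomeProb (𝒯.walk D) none ε (fun _ => false)

open Classical in
/-- The answer "there is a marked vertex" is given on the measured values `o` of `k` runs if and
only if at least `3 / 8` of the runs accept. -/
def AnswersYes {s k : ℕ} (o : Fin k → Fin s → Bool) : Prop :=
  3 * k ≤ 8 * (Finset.univ.filter fun i => o i = fun _ => false).card

open Classical in
/-- The probability that the answer given after `k` independent runs is correct. -/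
noncomputable def successProb (D : ℕ) (ε : ℝ) (k : ℕ) : ℝ :=
  ∑ o ∈ Finset.univ.filter
      (fun o : Fin k → Fin (qubits ε) → Bool => AnswersYes o ↔ ∃ v, 𝒯.Marked v),
    ∏ i, outcomeProb (𝒯.walk D) none ε (o i)

end ComputationTree

/-!
The sets consisting of a vertex of the expanded tree and its children, taken over the vertices at
even distance from the root, partition all vertices; over those at odd distance, they partition all
vertices but the root. So the `ψ_x` at the levels of one parity are orthonormal, and `R_A`, `R_B`
are the reflections about the orthogonal complements of the `ψ_x` with `x` unmarked of that parity
(`reflA_eq`, `reflB_eq`). Phase estimation on `|r⟩` yields `0^s` with probability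
`‖2⁻ˢ ∑_{n < 2ˢ} Uⁿ |r⟩‖²` (`outcomeProb_zero`), and this is estimated without any spectral theory.

If `m` is marked, let `φ` be the vector on the path from `m` to the root whose entry at `x` is
`±1 / √w_x` with alternating signs. An unmarked `ψ_x` meets the path in two neighbours, which cancel,
or not at all, so `U φ = φ` (`walk_mulVec_pathVector`). Here `|⟨r|φ⟩|² = D`, and
`‖φ‖² = D + ∑ t_v · (1 / t_v) ≤ 2 D`, where `v` runs over the at most `D` vertices of the path other
than the root. As `⟨φ|Uⁿ r⟩ = ⟨φ|r⟩` for all `n`, the Cauchy-Schwarz inequality bounds the acceptance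
probability below by `1 / 2` (`norm_sq_le_mul_outcomeProb_zero`).

If nothing is marked, let `u` have the entries `√(D w_y)`. It is in the span of the `ψ_x` at even
levels, and `u - |r⟩` is in the span of those at odd levels, since `√(D w_r) = 1`. So
`R_A u = -u` and `R_B u = -u + 2 |r⟩`, that is, `2 |r⟩ = (1 - U) u` (`walk_mulVec_sqrt_weight`). The
sum of the `Uⁿ |r⟩` telescopes, and the acceptance probability is at most
`‖u‖² / 4ˢ = (1 + T D) / 4ˢ` (`outcomeProb_zero_le`), which is at most `1 / 4` because
`2ˢ ≥ 8 √(T D)`.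

The measured values have total probability `1` by Parseval's identity for the Fourier transform
(`sum_outcomeProb`), and Chernoff's bound for `40` independent runs amplifies the gap
(`two_thirds_le_sum_prod`).
-/

/-! ### The state produced by phase estimation -/

namespace PhaseEstimation

open Finset Matrix

/-- Every number below `2 ^ s` is the value of exactly one string of `s` bits. -/
theorem sum_val {s : ℕ} {M : Type*} [AddCommMonoid M] (g : ℕ → M) :
    ∑ b : Fin s → Bool, g (val b) = ∑ n ∈ range (2 ^ s), g n := by
  rw [← Fin.sum_univ_eq_sum_range]
  refine Fintype.sum_equiv ((Equiv.piCongrRight fun _ => finTwoEquiv.symm).trans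
    finFunctionFinEquiv) _ _ fun b => ?_
  congr 1
  rw [Equiv.trans_apply, finFunctionFinEquiv_apply_val]
  refine sum_congr rfl fun i _ => ?_
  cases h : b i <;> simp [finTwoEquiv, h]

variable {X : Type*} [Fintype X]

theorem run_append (U : Matrix X X ℂ) {s : ℕ} (l l' : List (Gate s))
    (φ : X × (Fin s → Bool) → ℂ) : run U (l ++ l') φ = run U l' (run U l φ) :=
  List.foldl_append

theorem hadamard_apply_prod (U : Matrix X X ℂ) {s : ℕ} (i : Fin s) (a : X → ℂ)
    (f : Fin s → Bool → ℂ) :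
    (Gate.hadamard i).apply U (fun p => a p.1 * ∏ j, f j (p.2 j)) =
      fun p => a p.1 * ∏ j, Function.update f i
        (fun b => (f i false + (if b then -1 else 1) * f i true) / (√2 : ℝ)) j (p.2 j) := by
  funext p
  have key : ∀ (g : Fin s → Bool → ℂ) (b : Fin s → Bool),
      (∀ j, j ≠ i → g j = f j ∧ b j = p.2 j) →
      ∏ j, g j (b j) = g i (b i) * ∏ j ∈ univ.erase i, f j (p.2 j) := by
    intro g b h
    rw [← mul_prod_erase univ _ (mem_univ i)]
    congr 1
    refine prod_congr rfl fun j hj => ?_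
    rw [(h j (ne_of_mem_erase hj)).1, (h j (ne_of_mem_erase hj)).2]
  simp only [Gate.apply]
  rw [key f (Function.update p.2 i false) fun j hj => ⟨rfl, by simp [hj]⟩,
    key f (Function.update p.2 i true) fun j hj => ⟨rfl, by simp [hj]⟩,
    key (Function.update f i _) p.2 fun j hj => ⟨by simp [hj], rfl⟩]
  simp only [Function.update_self]
  ring

/-- Hadamard gates on the qubits in `l` turn `|0⟩` into `(|0⟩ + |1⟩) / √2` on these qubits and leave the
other factors of a product state alone. -/
theorem run_hadamard_prod (U : Matrix X X ℂ) {s : ℕ} (a : X → ℂ) (l : List (Fin s)) :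
    ∀ f : Fin s → Bool → ℂ, l.Nodup → (∀ i ∈ l, f i = fun b => if b then 0 else 1) →
    run U (l.map Gate.hadamard) (fun p => a p.1 * ∏ j, f j (p.2 j)) =
      fun p => a p.1 * ∏ j, if j ∈ l then (1 : ℂ) / (√2 : ℝ) else f j (p.2 j) := by
  induction l with
  | nil => intro f _ _; simp [run]
  | cons i l ih =>
    intro f hl hf
    rw [List.nodup_cons] at hl
    have h1 : run U ((i :: l).map Gate.hadamard) (fun p => a p.1 * ∏ j, f j (p.2 j)) =
        run U (l.map Gate.hadamard)
          ((Gate.hadamard i).apply U (fun p => a p.1 * ∏ j, f j (p.2 j))) := rfl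
    rw [h1, hadamard_apply_prod, ih _ hl.2]
    · funext p
      congr 1
      refine prod_congr rfl fun j _ => ?_
      by_cases hj : j = i
      · subst hj
        simp [hl.1, hf]
      · simp [hj]
    · intro j hj
      have : j ≠ i := fun h => hl.1 (h ▸ hj)
      simp [this, hf j (List.mem_cons_of_mem _ hj)]

theorem star_dotProduct_self_eq_sum (v : X → ℂ) :
    star v ⬝ᵥ v = ((∑ x, ‖v x‖ ^ 2 : ℝ) : ℂ) := by
  simp [dotProduct, Complex.conj_mul']

theorem outcomeProb_nonneg (U : Matrix X X ℂ) (x₀ : X) (ε : ℝ) (b : Fin (qubits ε) → Bool) :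
    0 ≤ outcomeProb U x₀ ε b :=
  sum_nonneg fun _ _ => by positivity

variable [DecidableEq X]

theorem run_replicate_controlledU (U : Matrix X X ℂ) {s : ℕ} (a : X → ℂ) (i : Fin s) (n : ℕ) :
    ∀ e : (Fin s → Bool) → ℕ,
    run U (List.replicate n (Gate.controlledU i)) (fun p => ((U ^ e p.2) *ᵥ a) p.1) =
      fun p => ((U ^ (e p.2 + if p.2 i then n else 0)) *ᵥ a) p.1 := by
  induction n with
  | zero => intro e; simp [run]
  | succ n ih =>
    intro e
    have h1 : (Gate.controlledU i).apply U (fun p => ((U ^ e p.2) *ᵥ a) p.1) =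
        fun p => ((U ^ (e p.2 + if p.2 i then 1 else 0)) *ᵥ a) p.1 := by
      funext p
      by_cases hp : p.2 i
      · simp only [Gate.apply, hp, if_true, pow_succ', ← mulVec_mulVec]
        rfl
      · simp [Gate.apply, hp]
    have h2 : run U (List.replicate (n + 1) (Gate.controlledU i))
          (fun p => ((U ^ e p.2) *ᵥ a) p.1) =
        run U (List.replicate n (Gate.controlledU i))
          ((Gate.controlledU i).apply U (fun p => ((U ^ e p.2) *ᵥ a) p.1)) := rfl
    rw [h2, h1, ih fun b => e b + if b i then 1 else 0]
    funext p
    by_cases hp : p.2 i <;> simp [hp, add_comm, add_left_comm]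

/-- The controlled powers raise the exponent of `U` by the part of the phase value that is read from
the qubits in `l`. -/
theorem run_controlledPowers (U : Matrix X X ℂ) {s : ℕ} (a : X → ℂ) (l : List (Fin s)) :
    ∀ e : (Fin s → Bool) → ℕ,
    run U (l.flatMap fun i : Fin s => List.replicate (2 ^ (i : ℕ)) (Gate.controlledU i))
        (fun p => ((U ^ e p.2) *ᵥ a) p.1) =
      fun p => ((U ^ (e p.2 + (l.map fun i : Fin s =>
        if p.2 i then 2 ^ (i : ℕ) else 0).sum)) *ᵥ a) p.1 := by
  induction l with
  | nil => intro e; simp [run]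
  | cons i l ih =>
    intro e
    rw [List.flatMap_cons, run_append, run_replicate_controlledU,
      ih fun b => e b + if b i then 2 ^ (i : ℕ) else 0]
    simp [add_assoc]

/-- The final state of the circuit: the amplitude of `|x⟩|b⟩` is the Fourier coefficient at `b` of
the orbit `n ↦ (U ^ n |x₀⟩) x`. -/
theorem run_circuit (U : Matrix X X ℂ) (x₀ : X) (s : ℕ) (x : X) (b : Fin s → Bool) :
    run U (circuit s) (initial x₀ s) (x, b) =
      (∑ n ∈ range (2 ^ s), Complex.exp (-(2 * Real.pi * Complex.I * val b * n / 2 ^ s)) *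
        ((U ^ n) *ᵥ Pi.single x₀ 1) x) / 2 ^ s := by
  have h0 : initial x₀ s = fun p : X × (Fin s → Bool) =>
      (Pi.single x₀ 1 : X → ℂ) p.1 * ∏ j, (fun c : Bool => if c then (0 : ℂ) else 1) (p.2 j) := by
    funext p
    have : (∏ j, (if p.2 j then (0 : ℂ) else 1)) = if p.2 = fun _ => false then 1 else 0 := by
      split_ifs with h
      · simp [h]
      · obtain ⟨j, hj⟩ := Function.ne_iff.1 h
        exact prod_eq_zero (mem_univ j) (by simpa using hj)
    simp only [initial, Pi.single_apply, this, Prod.ext_iff]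
    split_ifs <;> simp_all
  have h1 : run U ((List.finRange s).map Gate.hadamard) (initial x₀ s) =
      fun p => ((U ^ (fun _ : Fin s → Bool => 0) p.2) *ᵥ
        (fun y => (Pi.single x₀ 1 : X → ℂ) y * (1 / (√2 : ℝ)) ^ s)) p.1 := by
    rw [h0, run_hadamard_prod U _ _ (fun _ c => if c then (0 : ℂ) else 1)
      (List.nodup_finRange s) fun _ _ => rfl]
    simp
  have h2 : (√(2 ^ s) : ℝ) = √2 ^ s := by
    rw [Real.sqrt_eq_iff_mul_self_eq (by positivity) (by positivity), ← mul_pow]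
    simp
  have h3 : ((√2 : ℝ) : ℂ) ^ s * ((√2 : ℝ) : ℂ) ^ s = 2 ^ s := by
    rw [← mul_pow, ← Complex.ofReal_mul]; simp
  rw [circuit, run_append, run_append, h1, run_controlledPowers U _ _ fun _ => 0]
  simp only [run, List.foldl_cons, List.foldl_nil, Gate.apply, zero_add]
  have h4 : ∀ c : Fin s → Bool,
      ((List.finRange s).map fun i : Fin s => if c i then 2 ^ (i : ℕ) else 0).sum = val c := by
    intro c
    rw [val, ← List.sum_ofFn, List.ofFn_eq_map]
  simp only [h4]
  have h5 : ∀ (n : ℕ), ((U ^ n) *ᵥ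
      (fun y => (Pi.single x₀ 1 : X → ℂ) y * (1 / (√2 : ℝ)) ^ s)) x =
      ((U ^ n) *ᵥ Pi.single x₀ 1) x * (1 / (√2 : ℝ)) ^ s := by
    intro n
    simp only [mulVec, dotProduct, ← mul_assoc, ← sum_mul]
  simp only [h5]
  rw [sum_val (fun n => Complex.exp (-(2 * Real.pi * Complex.I * val b * n / 2 ^ s)) *
    (((U ^ n) *ᵥ Pi.single x₀ 1) x * (1 / (√2 : ℝ)) ^ s))]
  simp only [← mul_assoc, ← sum_mul]
  rw [h2, ← h3, div_pow, one_pow, Complex.ofReal_pow]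
  field_simp

/-- Parseval's identity for the discrete Fourier transform of length `N`. -/
theorem sum_norm_sq_dft (N : ℕ) (hN : N ≠ 0) (v : ℕ → ℂ) :
    ∑ m ∈ range N, ‖∑ n ∈ range N,
        Complex.exp (-(2 * Real.pi * Complex.I * m * n / N)) * v n‖ ^ 2 =
      N * ∑ n ∈ range N, ‖v n‖ ^ 2 := by
  obtain ⟨ω, hω⟩ : ∃ ω : ℂ, ω = (Complex.exp (2 * Real.pi * Complex.I / N))⁻¹ := ⟨_, rfl⟩
  have hprim : IsPrimitiveRoot ω N := hω ▸ (Complex.isPrimitiveRoot_exp N hN).inv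
  have hωn : ‖ω‖ = 1 := hprim.norm'_eq_one hN
  have hconj : (starRingEnd ℂ) ω = ω⁻¹ := by
    rw [Complex.inv_def, Complex.normSq_eq_norm_sq, hωn]; simp
  have hexp : ∀ m n : ℕ, Complex.exp (-(2 * Real.pi * Complex.I * m * n / N)) = ω ^ (m * n) := by
    intro m n
    rw [hω, ← Complex.exp_neg, ← Complex.exp_nat_mul]
    congr 1
    push_cast
    ring
  have horth : ∀ n ∈ range N, ∀ n' ∈ range N,
      ∑ m ∈ range N, ω ^ (m * n) * (starRingEnd ℂ) (ω ^ (m * n')) = if n = n' then (N : ℂ) else 0 := by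
    intro n hn n' hn'
    have hω0 : ω ≠ 0 := hprim.ne_zero hN
    have hgeom : ∀ m, ω ^ (m * n) * (starRingEnd ℂ) (ω ^ (m * n')) = (ω ^ n * (ω ^ n')⁻¹) ^ m := by
      intro m
      rw [map_pow, hconj, mul_pow, inv_pow, ← pow_mul, inv_pow, ← pow_mul, mul_comm m n,
        mul_comm m n']
    simp only [hgeom]
    split_ifs with h
    · subst h
      simp [hω0]
    · have hne : ω ^ n * (ω ^ n')⁻¹ ≠ 1 := by
        intro h1
        rw [mul_inv_eq_one₀ (pow_ne_zero _ hω0)] at h1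
        exact h (hprim.pow_inj (mem_range.1 hn) (mem_range.1 hn') h1)
      rw [geom_sum_eq hne, mul_pow, inv_pow, ← pow_mul, ← pow_mul, mul_comm n, mul_comm n',
        pow_mul, pow_mul, hprim.pow_eq_one]
      simp
  have hC : (∑ m ∈ range N, ((‖∑ n ∈ range N, ω ^ (m * n) * v n‖ ^ 2 : ℝ) : ℂ)) =
      N * ∑ n ∈ range N, ((‖v n‖ ^ 2 : ℝ) : ℂ) := by
    simp only [Complex.ofReal_pow, ← Complex.mul_conj', map_sum, map_mul, sum_mul_sum]
    rw [sum_comm, mul_sum]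
    refine sum_congr rfl fun n hn => ?_
    rw [sum_comm]
    calc _ = ∑ n' ∈ range N, (if n = n' then (N : ℂ) else 0) * (v n * (starRingEnd ℂ) (v n')) := by
          refine sum_congr rfl fun n' hn' => ?_
          rw [← horth n hn n' hn', sum_mul]
          exact sum_congr rfl fun m _ => by ring
      _ = _ := by
          rw [Finset.sum_eq_single n]
          · simp
          · intro n' _ h
            simp [h.symm]
          · intro h
            exact absurd hn h
  simp only [hexp]
  exact_mod_cast hC

theorem star_dotProduct_mulVec_of_mem_unitaryGroup {U : Matrix X X ℂ}
    (hU : U ∈ unitaryGroup X ℂ) (v w : X → ℂ) :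
    star (U *ᵥ v) ⬝ᵥ (U *ᵥ w) = star v ⬝ᵥ w := by
  rw [star_mulVec, ← dotProduct_mulVec, mulVec_mulVec, ← star_eq_conjTranspose,
    mem_unitaryGroup_iff'.1 hU, one_mulVec]

theorem sum_norm_sq_mulVec {U : Matrix X X ℂ} (hU : U ∈ unitaryGroup X ℂ) (v : X → ℂ) :
    ∑ x, ‖(U *ᵥ v) x‖ ^ 2 = ∑ x, ‖v x‖ ^ 2 := by
  have := star_dotProduct_mulVec_of_mem_unitaryGroup hU v v
  rw [star_dotProduct_self_eq_sum, star_dotProduct_self_eq_sum] at this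
  exact_mod_cast this

theorem outcomeProb_eq (U : Matrix X X ℂ) (x₀ : X) (ε : ℝ) (b : Fin (qubits ε) → Bool) :
    outcomeProb U x₀ ε b = ∑ x, ‖∑ n ∈ range (2 ^ qubits ε),
      Complex.exp (-(2 * Real.pi * Complex.I * val b * n / 2 ^ qubits ε)) *
        ((U ^ n) *ᵥ Pi.single x₀ 1) x‖ ^ 2 / (2 ^ qubits ε) ^ 2 := by
  simp [outcomeProb, run_circuit, div_pow]

/-- The probabilities of the measured values add up to `1`. -/
theorem sum_outcomeProb {U : Matrix X X ℂ} (hU : U ∈ unitaryGroup X ℂ) (x₀ : X) (ε : ℝ) :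
    ∑ b, outcomeProb U x₀ ε b = 1 := by
  simp only [outcomeProb_eq]
  set s := qubits ε
  rw [sum_val (fun m => ∑ x, ‖∑ n ∈ range (2 ^ s),
      Complex.exp (-(2 * Real.pi * Complex.I * m * n / 2 ^ s)) *
        ((U ^ n) *ᵥ Pi.single x₀ 1) x‖ ^ 2 / (2 ^ s) ^ 2), sum_comm]
  have hpars : ∀ x, ∑ m ∈ range (2 ^ s), ‖∑ n ∈ range (2 ^ s),
      Complex.exp (-(2 * Real.pi * Complex.I * m * n / 2 ^ s)) *
        ((U ^ n) *ᵥ Pi.single x₀ 1) x‖ ^ 2 / (2 ^ s : ℝ) ^ 2 =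
      (∑ n ∈ range (2 ^ s), ‖((U ^ n) *ᵥ Pi.single x₀ 1) x‖ ^ 2) / 2 ^ s := by
    intro x
    have := sum_norm_sq_dft (2 ^ s) (by positivity) fun n => ((U ^ n) *ᵥ Pi.single x₀ 1) x
    push_cast at this
    rw [← sum_div, this]
    field_simp
  simp only [hpars]
  rw [← sum_div, sum_comm]
  have hnorm : ∀ n, ∑ x, ‖((U ^ n) *ᵥ Pi.single x₀ 1) x‖ ^ 2 = 1 := by
    intro n
    rw [sum_norm_sq_mulVec (pow_mem hU n)]
    rw [Finset.sum_eq_single x₀] <;> simp +contextual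
  simp only [hnorm]
  simp

/-- The measured value is `0 … 0` with probability the squared norm of the average of the orbit
of `|x₀⟩`. -/
theorem outcomeProb_zero (U : Matrix X X ℂ) (x₀ : X) (ε : ℝ) :
    outcomeProb U x₀ ε (fun _ => false) =
      (∑ x, ‖(∑ n ∈ range (2 ^ qubits ε), (U ^ n) *ᵥ Pi.single x₀ 1) x‖ ^ 2) /
        (2 ^ qubits ε) ^ 2 := by
  rw [outcomeProb_eq, sum_div]
  simp [val]

/-- If `φ` is fixed by `U`, then phase estimation yields `0 … 0` with at least the probability
`|⟨φ|x₀⟩|² / ‖φ‖²`. -/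
theorem norm_sq_le_mul_outcomeProb_zero {U : Matrix X X ℂ} (hU : U ∈ unitaryGroup X ℂ) (x₀ : X)
    (ε : ℝ) (φ : X → ℂ) (hφ : U *ᵥ φ = φ) :
    ‖φ x₀‖ ^ 2 ≤ (∑ x, ‖φ x‖ ^ 2) * outcomeProb U x₀ ε (fun _ => false) := by
  rw [outcomeProb_zero]
  set N := 2 ^ qubits ε with hN
  set a := ∑ n ∈ range N, (U ^ n) *ᵥ (Pi.single x₀ 1 : X → ℂ) with ha
  have hfix : ∀ n, (U ^ n) *ᵥ φ = φ := by
    intro n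
    induction n with
    | zero => simp
    | succ n ih => rw [pow_succ, ← mulVec_mulVec, hφ, ih]
  have hdot : star φ ⬝ᵥ a = N * star (φ x₀) := by
    have : ∀ n, star φ ⬝ᵥ ((U ^ n) *ᵥ (Pi.single x₀ 1 : X → ℂ)) = star (φ x₀) := by
      intro n
      nth_rw 1 [← hfix n]
      rw [star_dotProduct_mulVec_of_mem_unitaryGroup (pow_mem hU n)]
      simp
    rw [ha, dotProduct_sum]
    simp only [this]
    simp
  have hcs : ‖star φ ⬝ᵥ a‖ ^ 2 ≤ (∑ x, ‖φ x‖ ^ 2) * ∑ x, ‖a x‖ ^ 2 := by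
    refine le_trans ?_ (sum_mul_sq_le_sq_mul_sq univ (fun x => ‖φ x‖) fun x => ‖a x‖)
    gcongr
    refine (norm_sum_le _ _).trans (le_of_eq ?_)
    simp
  rw [hdot, norm_mul, norm_star, mul_pow] at hcs
  have hN0 : (0 : ℝ) < 2 ^ qubits ε := by positivity
  rw [← mul_div_assoc, le_div_iff₀ (by positivity)]
  calc ‖φ x₀‖ ^ 2 * (2 ^ qubits ε) ^ 2 = ‖(N : ℂ)‖ ^ 2 * ‖φ x₀‖ ^ 2 := by
        rw [hN]; simp [mul_comm]
    _ ≤ _ := hcs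

/-- If `2 |x₀⟩ = (1 - U) u`, the sum of the orbit of `|x₀⟩` telescopes, so that phase estimation
yields `0 … 0` with at most the probability `‖u‖² / 4 ^ s`. -/
theorem outcomeProb_zero_le {U : Matrix X X ℂ} (hU : U ∈ unitaryGroup X ℂ) (x₀ : X) (ε : ℝ)
    (u : X → ℂ) (hu : U *ᵥ u = u - (2 : ℂ) • Pi.single x₀ 1) :
    outcomeProb U x₀ ε (fun _ => false) ≤ (∑ x, ‖u x‖ ^ 2) / (2 ^ qubits ε) ^ 2 := by
  rw [outcomeProb_zero]
  gcongr ?_ / _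
  set N := 2 ^ qubits ε
  have hx : (Pi.single x₀ 1 : X → ℂ) = (1 / 2 : ℂ) • (u - U *ᵥ u) := by
    rw [hu]
    simp [smul_smul]
  have hsum : ∑ n ∈ range N, (U ^ n) *ᵥ (Pi.single x₀ 1 : X → ℂ) =
      (1 / 2 : ℂ) • (u - (U ^ N) *ᵥ u) := by
    have h := sum_range_sub' (fun n => (U ^ n) *ᵥ u) N
    simp only [pow_zero, one_mulVec] at h
    rw [← h, smul_sum, hx]
    refine sum_congr rfl fun n _ => ?_
    rw [mulVec_smul, mulVec_sub, mulVec_mulVec, pow_succ]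
  rw [hsum]
  have hpar : ∀ x, ‖((1 / 2 : ℂ) • (u - (U ^ N) *ᵥ u)) x‖ ^ 2 ≤
      (‖u x‖ ^ 2 + ‖((U ^ N) *ᵥ u) x‖ ^ 2) / 2 := by
    intro x
    have h := norm_sub_le (u x) (((U ^ N) *ᵥ u) x)
    simp only [Pi.smul_apply, Pi.sub_apply, norm_smul, mul_pow]
    norm_num
    nlinarith [sq_nonneg (‖u x‖ - ‖((U ^ N) *ᵥ u) x‖), norm_nonneg (u x - ((U ^ N) *ᵥ u) x)]
  refine (sum_le_sum fun x _ => hpar x).trans (le_of_eq ?_)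
  rw [← sum_div, sum_add_distrib, sum_norm_sq_mulVec (pow_mem hU N)]
  ring

theorem uses_circuit_le (s : ℕ) : uses (circuit s) ≤ 2 ^ s := by
  have h1 : ∀ l : List (Fin s), uses (l.map Gate.hadamard) = 0 := by
    intro l
    simp [uses, Function.comp_def, Gate.uses]
  have h2 : ∀ l : List (Fin s), uses (l.flatMap fun i : Fin s =>
      List.replicate (2 ^ (i : ℕ)) (Gate.controlledU i)) =
        (l.map fun i : Fin s => 2 ^ (i : ℕ)).sum := by
    intro l
    induction l with
    | nil => rfl
    | cons i l ih =>
      simp only [uses] at ih ⊢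
      simp [List.flatMap_cons, ih, Gate.uses]
  have h3 : uses (circuit s) = uses ((List.finRange s).map Gate.hadamard) +
      uses ((List.finRange s).flatMap fun i : Fin s =>
        List.replicate (2 ^ (i : ℕ)) (Gate.controlledU i)) := by
    simp [circuit, uses, Gate.uses]
  rw [h3, h1, h2, zero_add, ← List.ofFn_eq_map, List.sum_ofFn,
    Fin.sum_univ_eq_sum_range (fun i => 2 ^ i)]
  exact (Nat.geomSum_lt le_rfl (by simp)).le

theorem le_two_pow_qubits {ε : ℝ} : 8 * (1 / ε) ≤ 2 ^ qubits ε := by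
  have h : (⌈1 / ε⌉₊ : ℝ) ≤ 2 ^ Nat.clog 2 ⌈1 / ε⌉₊ := by
    exact_mod_cast Nat.le_pow_clog one_lt_two _
  rw [qubits, pow_add]
  linarith [Nat.le_ceil (1 / ε)]

theorem two_pow_qubits_le {ε : ℝ} (hε : 0 < ε) (hε1 : ε ≤ 1) :
    (2 : ℝ) ^ qubits ε ≤ 32 * (1 / ε) := by
  have h1 : 1 ≤ 1 / ε := by rwa [le_div_iff₀ hε, one_mul]
  have h : (2 : ℝ) ^ Nat.clog 2 ⌈1 / ε⌉₊ ≤ 2 * ⌈1 / ε⌉₊ := by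
    have h0 : 1 ≤ ⌈1 / ε⌉₊ := Nat.one_le_ceil_iff.2 (by positivity)
    rcases h0.eq_or_lt with h0 | h0
    · rw [← h0]; norm_num
    · have := Nat.pow_pred_clog_lt_self one_lt_two h0
      have hpos := Nat.clog_pos one_lt_two h0
      have h2 : 2 ^ Nat.clog 2 ⌈1 / ε⌉₊ = 2 * 2 ^ (Nat.clog 2 ⌈1 / ε⌉₊).pred := by
        rw [← pow_succ']
        congr 1
        exact (Nat.succ_pred_eq_of_pos hpos).symm
      have h3 : 2 ^ Nat.clog 2 ⌈1 / ε⌉₊ ≤ 2 * ⌈1 / ε⌉₊ := by omega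
      exact_mod_cast h3
  rw [qubits, pow_add]
  linarith [Nat.ceil_lt_add_one (zero_le_one.trans h1)]

end PhaseEstimation

/-! ### Products of reflections -/

namespace Matrix

open Finset

variable {X : Type*} [Fintype X]

theorem sum_vecMulVec_mulVec (v : X → X → ℂ) (S : Finset X) (φ : X → ℂ) :
    (∑ x ∈ S, vecMulVec (v x) (star (v x))) *ᵥ φ = ∑ x ∈ S, (star (v x) ⬝ᵥ φ) • v x := by
  rw [sum_mulVec]
  refine sum_congr rfl fun x _ => ?_
  rw [vecMulVec_mulVec]
  simp

variable [DecidableEq X]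

theorem reflection_mulVec_of_orthogonal (v : X → X → ℂ) (S : Finset X) (φ : X → ℂ)
    (h : ∀ x ∈ S, star (v x) ⬝ᵥ φ = 0) :
    (1 - (2 : ℂ) • ∑ x ∈ S, vecMulVec (v x) (star (v x))) *ᵥ φ = φ := by
  rw [sub_mulVec, smul_mulVec, sum_vecMulVec_mulVec, sum_eq_zero]
  · simp
  · intro x hx
    rw [h x hx, zero_smul]

theorem reflection_mulVec_of_span (v : X → X → ℂ) (S : Finset X)
    (h : ∀ x ∈ S, ∀ x' ∈ S, star (v x) ⬝ᵥ v x' = if x = x' then 1 else 0) (c : X → ℂ) :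
    (1 - (2 : ℂ) • ∑ x ∈ S, vecMulVec (v x) (star (v x))) *ᵥ (∑ x ∈ S, c x • v x) =
      -∑ x ∈ S, c x • v x := by
  have hc : ∀ x ∈ S, star (v x) ⬝ᵥ (∑ x ∈ S, c x • v x) = c x := by
    intro x hx
    rw [dotProduct_sum, sum_eq_single x]
    · rw [dotProduct_smul, h x hx x hx]
      simp
    · intro x' hx' hne
      rw [dotProduct_smul, h x hx x' hx']
      simp [hne.symm]
    · exact fun h => absurd hx h
  rw [sub_mulVec, smul_mulVec, sum_vecMulVec_mulVec, one_mulVec,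
    sum_congr rfl fun x hx => congrArg (· • v x) (hc x hx)]
  module

theorem reflection_mem_unitaryGroup (v : X → X → ℂ) (S : Finset X)
    (h : ∀ x ∈ S, ∀ x' ∈ S, star (v x) ⬝ᵥ v x' = if x = x' then 1 else 0) :
    1 - (2 : ℂ) • ∑ x ∈ S, vecMulVec (v x) (star (v x)) ∈ unitaryGroup X ℂ := by
  set P := ∑ x ∈ S, vecMulVec (v x) (star (v x)) with hP
  have hstar : star P = P := by
    rw [hP, star_sum]
    refine sum_congr rfl fun x _ => ?_
    rw [star_eq_conjTranspose, conjTranspose_vecMulVec, star_star]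
  have hsq : P * P = P := by
    nth_rw 2 [hP]
    rw [hP, sum_mul_sum]
    refine sum_congr rfl fun x hx => ?_
    rw [sum_eq_single x]
    · rw [vecMulVec_mul_vecMulVec, h x hx x hx]
      simp
    · intro x' hx' hne
      rw [vecMulVec_mul_vecMulVec, h x hx x' hx']
      simp [hne.symm]
    · exact fun h => absurd hx h
  rw [mem_unitaryGroup_iff, star_sub, star_smul, hstar, star_one]
  simp only [star_ofNat, sub_mul, mul_sub, one_mul, mul_one, smul_mul_assoc, mul_smul_comm, hsq]
  module

end Matrix

/-! ### Levels -/

namespace ParentTree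

variable {V : Type*} (P : ParentTree V)

theorem level_root : P.level P.root = 0 := by
  simp [level, Nat.find_eq_zero]

theorem iterate_level (v : V) : P.parent^[P.level v] v = P.root := by
  classical exact Nat.find_spec (P.reaches_root v)

theorem level_eq_succ {v : V} (hv : v ≠ P.root) : P.level v = P.level (P.parent v) + 1 := by
  classical
  rw [level, Nat.find_eq_iff]
  refine ⟨P.iterate_level (P.parent v), fun n hn h => ?_⟩
  rcases n with _ | n
  · exact hv h
  · exact Nat.find_min (P.reaches_root (P.parent v)) (Nat.lt_of_succ_lt_succ hn) h

theorem level_iterate_add (v : V) {k : ℕ} (hk : k ≤ P.level v) :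
    P.level (P.parent^[k] v) + k = P.level v := by
  induction k with
  | zero => simp
  | succ k ih =>
    have h := ih (Nat.le_of_succ_le hk)
    have hne : P.parent^[k] v ≠ P.root := by
      intro h0
      rw [h0, P.level_root] at h
      omega
    rw [P.level_eq_succ hne] at h
    rw [Function.iterate_succ_apply']
    omega

end ParentTree

namespace ComputationTree

open Finset Matrix

variable {G : RootedTree} (𝒯 : ComputationTree G)

theorem weight_pos {D : ℕ} (hD : 0 < D) (x : 𝒯.ExpVertex) : 0 < 𝒯.weight D x := by
  rcases x with _ | ⟨v, i⟩
  · simp [weight, hD]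
  · simpa [weight] using i.pos

theorem level_none : 𝒯.expanded.level none = 0 := 𝒯.expanded.level_root

theorem level_eq_succ {y : 𝒯.ExpVertex} (hy : y ≠ none) :
    𝒯.expanded.level y = 𝒯.expanded.level (𝒯.expParent y) + 1 :=
  𝒯.expanded.level_eq_succ hy

theorem level_iterate_add (e : 𝒯.ExpVertex) {k : ℕ} (hk : k ≤ 𝒯.expanded.level e) :
    𝒯.expanded.level (𝒯.expParent^[k] e) + k = 𝒯.expanded.level e :=
  𝒯.expanded.level_iterate_add e hk

/-! ### Paths to the root -/

open Classical in
/-- The vector supported on the path from `e` to the root, with alternating signs and squared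
amplitudes the inverses of the weights. -/
noncomputable def pathVector (D : ℕ) (e : 𝒯.ExpVertex) : 𝒯.ExpVertex → ℂ := fun y =>
  ∑ k ∈ range (𝒯.expanded.level e + 1),
    if 𝒯.expParent^[k] e = y then (-1) ^ k * ((1 / √(𝒯.weight D y) : ℝ) : ℂ) else 0

theorem iterate_ne_none (e : 𝒯.ExpVertex) {k : ℕ} (hk : k < 𝒯.expanded.level e) :
    𝒯.expParent^[k] e ≠ none := by
  intro h
  have := 𝒯.level_iterate_add e hk.le
  rw [h, level_none] at this
  omega

theorem pathVector_iterate (D : ℕ) (e : 𝒯.ExpVertex) {k : ℕ} (hk : k ≤ 𝒯.expanded.level e) :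
    𝒯.pathVector D e (𝒯.expParent^[k] e) =
      (-1) ^ k * ((1 / √(𝒯.weight D (𝒯.expParent^[k] e)) : ℝ) : ℂ) := by
  rw [pathVector, sum_eq_single k]
  · simp
  · intro j hj hne
    refine if_neg fun h => hne ?_
    have h1 := 𝒯.level_iterate_add e (Nat.lt_succ_iff.1 (mem_range.1 hj))
    have h2 := 𝒯.level_iterate_add e hk
    rw [h] at h1
    omega
  · intro h
    exact absurd (mem_range.2 (Nat.lt_succ_iff.2 hk)) h

theorem norm_sq_pathVector_none (D : ℕ) (e : 𝒯.ExpVertex) :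
    ‖𝒯.pathVector D e none‖ ^ 2 = D := by
  have h := 𝒯.pathVector_iterate D e le_rfl
  have h0 : 𝒯.expParent^[𝒯.expanded.level e] e = none := 𝒯.expanded.iterate_level e
  rw [h0] at h
  rw [h]
  simp [weight]

theorem eq_of_endpoint_eq {v w : G} {i : Fin (𝒯.time w)}
    (h : 𝒯.endpoint v = some ⟨w, i⟩) : w = v := by
  rw [endpoint] at h
  split_ifs at h
  simp only [Option.some.injEq, Sigma.mk.injEq] at h
  exact h.1.symm

/-- The vertices on the path from the endpoint of `m` to the root belong to ancestors of `m`. -/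
theorem le_of_iterate_eq (m : G) (k : ℕ) :
    ∀ (w : G) (i : Fin (𝒯.time w)), 𝒯.expParent^[k] (𝒯.endpoint m) = some ⟨w, i⟩ → w ≤ m := by
  induction k with
  | zero => exact fun w i h => (𝒯.eq_of_endpoint_eq h).le
  | succ k ih =>
    intro w i h
    rw [Function.iterate_succ_apply'] at h
    rcases hy : 𝒯.expParent^[k] (𝒯.endpoint m) with _ | ⟨v, j, hj⟩
    · rw [hy] at h
      cases h
    · have hv := ih v _ hy
      rw [hy] at h
      rcases j with _ | j
      · rw [𝒯.eq_of_endpoint_eq h]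
        exact (Order.pred_le v).trans hv
      · simp only [expParent, Option.some.injEq, Sigma.mk.injEq] at h
        exact h.1 ▸ hv

/-! ### Blocks of the expanded tree -/

variable [Fintype G]

theorem mem_block {x y : 𝒯.ExpVertex} :
    y ∈ 𝒯.block x ↔ y = x ∨ (y ≠ none ∧ 𝒯.expParent y = x) := by
  classical
  rw [block, mem_filter]
  exact and_iff_right (mem_univ y)

/-- The blocks of the vertices whose level has a given parity are disjoint, and their union is
everything, except that the blocks of odd level omit the root. The parity is given as a predicate `q`
that alternates on the natural numbers, so that `Even` and `Odd` are treated at once. -/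
theorem exists_block_iff {q : ℕ → Prop} (hq : ∀ n, q (n + 1) ↔ ¬ q n) {y : 𝒯.ExpVertex}
    (hy : y ≠ none ∨ q 0) :
    ∃ a, ∀ x, (q (𝒯.expanded.level x) ∧ y ∈ 𝒯.block x) ↔ x = a := by
  by_cases hqy : q (𝒯.expanded.level y)
  · refine ⟨y, fun x => ⟨?_, ?_⟩⟩
    · rintro ⟨hx, hyx⟩
      rcases 𝒯.mem_block.1 hyx with h | ⟨h0, h⟩
      · exact h.symm
      · rw [𝒯.level_eq_succ h0, h, hq] at hqy
        exact absurd hx hqy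
    · rintro rfl
      exact ⟨hqy, 𝒯.mem_block.2 (Or.inl rfl)⟩
  · have h0 : y ≠ none := by
      rintro rfl
      rw [𝒯.level_none] at hqy
      exact hy.elim (fun h => h rfl) hqy
    refine ⟨𝒯.expParent y, fun x => ⟨?_, ?_⟩⟩
    · rintro ⟨hx, hyx⟩
      rcases 𝒯.mem_block.1 hyx with h | ⟨_, h⟩
      · exact absurd (h ▸ hx) hqy
      · exact h.symm
    · rintro rfl
      rw [𝒯.level_eq_succ h0, hq, not_not] at hqy
      exact ⟨hqy, 𝒯.mem_block.2 (Or.inr ⟨h0, rfl⟩)⟩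

theorem none_mem_block {x : 𝒯.ExpVertex} : none ∈ 𝒯.block x ↔ x = none := by
  rw [𝒯.mem_block]
  simp [eq_comm]

theorem not_none_mem_block {q : ℕ → Prop} {x : 𝒯.ExpVertex} (h0 : ¬ q 0)
    (hx : q (𝒯.expanded.level x)) : none ∉ 𝒯.block x := by
  rw [none_mem_block]
  rintro rfl
  exact h0 (𝒯.level_none ▸ hx)

theorem eq_of_mem_block {q : ℕ → Prop} (hq : ∀ n, q (n + 1) ↔ ¬ q n) {x x' y : 𝒯.ExpVertex}
    (hx : q (𝒯.expanded.level x)) (hx' : q (𝒯.expanded.level x')) (hy : y ∈ 𝒯.block x)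
    (hy' : y ∈ 𝒯.block x') : x = x' := by
  have h0 : y ≠ none ∨ q 0 := by
    by_contra! h
    exact 𝒯.not_none_mem_block h.2 hx (h.1 ▸ hy)
  obtain ⟨a, ha⟩ := 𝒯.exists_block_iff hq h0
  rw [(ha x).1 ⟨hx, hy⟩, (ha x').1 ⟨hx', hy'⟩]

/-- The total weight of `x` and its children, the squared norm of the unnormalized `ψ_x`. -/
noncomputable def blockWeight (D : ℕ) (x : 𝒯.ExpVertex) : ℝ := ∑ z ∈ 𝒯.block x, 𝒯.weight D z

theorem blockWeight_pos {D : ℕ} (hD : 0 < D) (x : 𝒯.ExpVertex) : 0 < 𝒯.blockWeight D x :=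
  sum_pos (fun z _ => 𝒯.weight_pos hD z) ⟨x, 𝒯.mem_block.2 (Or.inl rfl)⟩

open Classical in
theorem psi_apply (D : ℕ) (x y : 𝒯.ExpVertex) :
    𝒯.psi D x y = if y ∈ 𝒯.block x then
      ((√(𝒯.weight D y) / √(𝒯.blockWeight D x) : ℝ) : ℂ) else 0 := rfl

theorem star_psi (D : ℕ) (x : 𝒯.ExpVertex) : star (𝒯.psi D x) = 𝒯.psi D x := by
  funext y
  rw [Pi.star_apply, psi_apply]
  split_ifs <;> simp

open Classical in
/-- The vectors `ψ_x` at the levels of one parity are orthonormal. -/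
theorem star_psi_dotProduct_psi {D : ℕ} (hD : 0 < D) {q : ℕ → Prop}
    (hq : ∀ n, q (n + 1) ↔ ¬ q n) {x x' : 𝒯.ExpVertex} (hx : q (𝒯.expanded.level x))
    (hx' : q (𝒯.expanded.level x')) :
    star (𝒯.psi D x) ⬝ᵥ 𝒯.psi D x' = if x = x' then 1 else 0 := by
  rw [star_psi, dotProduct]
  split_ifs with h
  · subst h
    have hterm : ∀ y, 𝒯.psi D x y * 𝒯.psi D x y =
        ((if y ∈ 𝒯.block x then 𝒯.weight D y / 𝒯.blockWeight D x else 0 : ℝ) : ℂ) := by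
      intro y
      rw [psi_apply]
      split_ifs
      · rw [← Complex.ofReal_mul, div_mul_div_comm, Real.mul_self_sqrt (𝒯.weight_pos hD y).le,
          Real.mul_self_sqrt (𝒯.blockWeight_pos hD x).le]
      · simp
    simp only [hterm]
    rw [← Complex.ofReal_sum, ← sum_filter, ← sum_div, filter_mem_eq_inter, univ_inter,
      ← blockWeight, div_self (𝒯.blockWeight_pos hD x).ne', Complex.ofReal_one]
  · refine sum_eq_zero fun y _ => ?_
    rw [psi_apply, psi_apply]
    split_ifs with h1 h2
    · exact absurd (𝒯.eq_of_mem_block hq hx hx' h1 h2) h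
    all_goals simp

open Classical in
theorem sum_blockProj {q : ℕ → Prop} [DecidablePred q] (hq : ∀ n, q (n + 1) ↔ ¬ q n) :
    ∑ x ∈ univ.filter (fun x => q (𝒯.expanded.level x)), 𝒯.blockProj x =
      diagonal fun y => if y = none ∧ ¬ q 0 then 0 else 1 := by
  have hdiag : ∀ S : Finset 𝒯.ExpVertex, ∑ x ∈ S, 𝒯.blockProj x =
      diagonal fun y => ∑ x ∈ S, if y ∈ 𝒯.block x then 1 else 0 := by
    intro S
    ext y z
    rw [Matrix.sum_apply]
    by_cases h : y = z
    · subst h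
      simp [blockProj]
    · simp [blockProj, h]
  rw [hdiag]
  congr 1
  funext y
  split_ifs with h
  · refine sum_eq_zero fun x hx => if_neg ?_
    rw [h.1]
    exact 𝒯.not_none_mem_block h.2 (mem_filter.1 hx).2
  · obtain ⟨a, ha⟩ := 𝒯.exists_block_iff hq (y := y) (by tauto)
    rw [sum_filter]
    simp only [← ite_and, ha]
    simp

open Classical in
/-- The unmarked vertices of the expanded tree whose level satisfies `q`. -/
noncomputable def unmarkedLevel (q : ℕ → Prop) : Finset 𝒯.ExpVertex :=
  univ.filter fun x => q (𝒯.expanded.level x) ∧ ¬ 𝒯.ExpMarked x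

theorem mem_unmarkedLevel {q : ℕ → Prop} {x : 𝒯.ExpVertex} :
    x ∈ 𝒯.unmarkedLevel q ↔ q (𝒯.expanded.level x) ∧ ¬ 𝒯.ExpMarked x := by
  simp [unmarkedLevel]

open Classical in
/-- The reflection about the orthogonal complement of the `ψ_x` for the unmarked `x` at the levels
in `q`. -/
noncomputable def levelReflection (D : ℕ) (q : ℕ → Prop) :
    Matrix 𝒯.ExpVertex 𝒯.ExpVertex ℂ :=
  1 - (2 : ℂ) • ∑ x ∈ 𝒯.unmarkedLevel q, vecMulVec (𝒯.psi D x) (star (𝒯.psi D x))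

open Classical in
theorem sum_diffusion (D : ℕ) {q : ℕ → Prop} [DecidablePred q] (hq : ∀ n, q (n + 1) ↔ ¬ q n) :
    ∑ x ∈ univ.filter (fun x => q (𝒯.expanded.level x)), 𝒯.diffusion D x =
      (diagonal fun y => if y = none ∧ ¬ q 0 then 0 else 1) -
        (2 : ℂ) • ∑ x ∈ 𝒯.unmarkedLevel q, vecMulVec (𝒯.psi D x) (star (𝒯.psi D x)) := by
  have hdiff : ∀ x, 𝒯.diffusion D x = 𝒯.blockProj x -
      (2 : ℂ) • (if ¬ 𝒯.ExpMarked x then vecMulVec (𝒯.psi D x) (star (𝒯.psi D x)) else 0) := by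
    intro x
    rw [diffusion]
    by_cases h : 𝒯.ExpMarked x <;> simp [h]
  simp only [hdiff]
  rw [sum_sub_distrib, 𝒯.sum_blockProj hq, ← smul_sum, ← sum_filter, filter_filter, unmarkedLevel]
  congr!

theorem even_alternates (n : ℕ) : Even (n + 1) ↔ ¬ Even n := Nat.even_add_one

theorem odd_alternates (n : ℕ) : Odd (n + 1) ↔ ¬ Odd n := Nat.odd_add_one

theorem reflA_eq (D : ℕ) : 𝒯.reflA D = 𝒯.levelReflection D Even := by
  classical
  rw [reflA, 𝒯.sum_diffusion D even_alternates, levelReflection]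
  congr 1
  simp

theorem reflB_eq (D : ℕ) : 𝒯.reflB D = 𝒯.levelReflection D Odd := by
  classical
  rw [reflB, 𝒯.sum_diffusion D odd_alternates, levelReflection, ← add_sub_assoc]
  congr 1
  ext y z
  by_cases h : y = z
  · subst h
    by_cases h0 : y = none
    · subst h0; simp
    · simp [h0, Ne.symm h0]
  · have : ¬ (none = y ∧ none = z) := fun h' => h (h'.1.symm.trans h'.2)
    simp [h, this]

open Classical in
theorem levelReflection_mem_unitaryGroup {D : ℕ} (hD : 0 < D) {q : ℕ → Prop}
    (hq : ∀ n, q (n + 1) ↔ ¬ q n) :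
    𝒯.levelReflection D q ∈ unitaryGroup 𝒯.ExpVertex ℂ :=
  reflection_mem_unitaryGroup _ _ fun _ hx _ hx' =>
    𝒯.star_psi_dotProduct_psi hD hq (𝒯.mem_unmarkedLevel.1 hx).1 (𝒯.mem_unmarkedLevel.1 hx').1

theorem walk_eq (D : ℕ) :
    𝒯.walk D = 𝒯.levelReflection D Odd * 𝒯.levelReflection D Even := by
  rw [walk, reflA_eq, reflB_eq]

theorem walk_mem_unitaryGroup [DecidableEq 𝒯.ExpVertex] {D : ℕ} (hD : 0 < D) :
    𝒯.walk D ∈ unitaryGroup 𝒯.ExpVertex ℂ := by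
  rw [walk_eq]
  refine mul_mem ?_ ?_
  · convert 𝒯.levelReflection_mem_unitaryGroup hD odd_alternates
  · convert 𝒯.levelReflection_mem_unitaryGroup hD even_alternates

theorem levelReflection_mulVec_of_orthogonal (D : ℕ) {q : ℕ → Prop} (φ : 𝒯.ExpVertex → ℂ)
    (h : ∀ x, q (𝒯.expanded.level x) → ¬ 𝒯.ExpMarked x → star (𝒯.psi D x) ⬝ᵥ φ = 0) :
    𝒯.levelReflection D q *ᵥ φ = φ := by
  classical
  refine reflection_mulVec_of_orthogonal _ _ _ fun x hx => ?_
  exact h x (𝒯.mem_unmarkedLevel.1 hx).1 (𝒯.mem_unmarkedLevel.1 hx).2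

/-! ### Trees without marked vertices -/

open Classical in
/-- Without marked vertices, `R_A` maps the vector of the `√(D w_y)` to its negative; so does `R_B` with
the same vector restricted to the vertices other than the root. -/
theorem levelReflection_mulVec_sqrt_weight {D : ℕ} (hD : 0 < D) {q : ℕ → Prop}
    (hq : ∀ n, q (n + 1) ↔ ¬ q n) (hm : ¬ ∃ v, 𝒯.Marked v) (u : 𝒯.ExpVertex → ℂ)
    (hu : ∀ y, u y = if y = none ∧ ¬ q 0 then 0 else ((√D * √(𝒯.weight D y) : ℝ) : ℂ)) :
    𝒯.levelReflection D q *ᵥ u = -u := by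
  have hunm : ∀ x, ¬ 𝒯.ExpMarked x := fun x ⟨v, hv, _⟩ => hm ⟨v, hv⟩
  have hsum : u = ∑ x ∈ 𝒯.unmarkedLevel q,
      ((√D * √(𝒯.blockWeight D x) : ℝ) : ℂ) • 𝒯.psi D x := by
    funext y
    have hterm : ∀ x, (((√D * √(𝒯.blockWeight D x) : ℝ) : ℂ) • 𝒯.psi D x) y =
        if y ∈ 𝒯.block x then ((√D * √(𝒯.weight D y) : ℝ) : ℂ) else 0 := by
      intro x
      have := (Real.sqrt_pos.2 (𝒯.blockWeight_pos hD x)).ne'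
      rw [Pi.smul_apply, psi_apply]
      split_ifs
      · rw [smul_eq_mul, ← Complex.ofReal_mul]
        congr 1
        field_simp
      · simp
    rw [hu, Finset.sum_apply]
    simp only [hterm]
    split_ifs with h
    · refine (sum_eq_zero fun x hx => if_neg ?_).symm
      rw [h.1]
      exact 𝒯.not_none_mem_block h.2 (𝒯.mem_unmarkedLevel.1 hx).1
    · obtain ⟨a, ha⟩ := 𝒯.exists_block_iff hq (y := y) (by tauto)
      simp only [unmarkedLevel, hunm, not_false_eq_true, and_true]
      rw [sum_filter]
      simp only [← ite_and, ha]
      simp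
  rw [hsum]
  exact reflection_mulVec_of_span _ _ (fun _ hx _ hx' => 𝒯.star_psi_dotProduct_psi hD hq
    (𝒯.mem_unmarkedLevel.1 hx).1 (𝒯.mem_unmarkedLevel.1 hx').1) _

open Classical in
/-- Without marked vertices, `(1 - U) u = 2 |r⟩` for the vector `u` of the `√(D w_y)`. -/
theorem walk_mulVec_sqrt_weight {D : ℕ} (hD : 0 < D) (hm : ¬ ∃ v, 𝒯.Marked v) :
    𝒯.walk D *ᵥ (fun y => ((√D * √(𝒯.weight D y) : ℝ) : ℂ)) =
      (fun y => ((√D * √(𝒯.weight D y) : ℝ) : ℂ)) - (2 : ℂ) • Pi.single none 1 := by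
  set u : 𝒯.ExpVertex → ℂ := fun y => ((√D * √(𝒯.weight D y) : ℝ) : ℂ) with hu
  have hroot : u none = 1 := by
    have : (√D : ℝ) ≠ 0 := by positivity
    simp [hu, weight, this]
  have hA : 𝒯.levelReflection D Even *ᵥ u = -u :=
    𝒯.levelReflection_mulVec_sqrt_weight hD even_alternates hm u fun y => by simp [hu]
  have hB : 𝒯.levelReflection D Odd *ᵥ (u - Pi.single none 1) = -(u - Pi.single none 1) := by
    refine 𝒯.levelReflection_mulVec_sqrt_weight hD odd_alternates hm _ fun y => ?_
    by_cases hy : y = none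
    · subst hy
      simp [hroot]
    · simp [hy, hu]
  have hr : 𝒯.levelReflection D Odd *ᵥ (Pi.single none 1) = Pi.single none 1 := by
    refine 𝒯.levelReflection_mulVec_of_orthogonal D _ fun x hx _ => ?_
    have : none ∉ 𝒯.block x := 𝒯.not_none_mem_block (by simp) hx
    rw [star_psi, dotProduct_single, psi_apply, if_neg this, zero_mul]
  rw [walk_eq, ← mulVec_mulVec, hA, mulVec_neg]
  have hsplit : u = (u - Pi.single none 1) + Pi.single none 1 := by abel
  nth_rw 1 [hsplit]
  rw [mulVec_add, hB, hr, two_smul]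
  abel

theorem sum_weight (D : ℕ) : ∑ y, 𝒯.weight D y = 1 / D + 𝒯.sqTime := by
  rw [Fintype.sum_option, Fintype.sum_sigma]
  simp [weight, sqTime, sq]

theorem sum_norm_sq_sqrt_weight {D : ℕ} (hD : 0 < D) :
    ∑ y, ‖((√D * √(𝒯.weight D y) : ℝ) : ℂ)‖ ^ 2 = 1 + 𝒯.sqTime * D := by
  have hterm : ∀ y, ‖((√D * √(𝒯.weight D y) : ℝ) : ℂ)‖ ^ 2 = D * 𝒯.weight D y := by
    intro y
    rw [Complex.norm_real, Real.norm_eq_abs, sq_abs, mul_pow, Real.sq_sqrt (by positivity),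
      Real.sq_sqrt (𝒯.weight_pos hD y).le]
  have hD' : (D : ℝ) ≠ 0 := by positivity
  simp only [hterm]
  rw [← mul_sum, sum_weight]
  field_simp

theorem one_le_sqTime (h : 0 < G.toParentTree.depth) : 1 ≤ 𝒯.sqTime := by
  obtain ⟨v, _, hv⟩ := (Finset.lt_sup_iff).1 h
  have hne : v ≠ ⊥ := by
    rintro rfl
    exact hv.ne' G.toParentTree.level_root
  have h1 : 1 ≤ 𝒯.time v ^ 2 := Nat.one_le_pow _ _ (𝒯.time_pos v hne)
  exact h1.trans (single_le_sum (f := fun v => 𝒯.time v ^ 2) (fun _ _ => Nat.zero_le _)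
    (mem_univ v))

/-! ### Trees with a marked vertex -/

/-- The two neighbouring vertices of the path in the block of an inner vertex `x` of the path
contribute to the inner product with `ψ_x` with opposite signs. -/
theorem star_psi_dotProduct_pathVector {D : ℕ} (hD : 0 < D) {e x : 𝒯.ExpVertex} (hx : x ≠ e) :
    star (𝒯.psi D x) ⬝ᵥ 𝒯.pathVector D e = 0 := by
  classical
  set L := 𝒯.expanded.level e with hL
  -- The cut-off `k ≤ L` matters because the iterates of the parent map stay at the root.
  let a : ℕ → ℂ := fun k => if k ≤ L ∧ 𝒯.expParent^[k] e = x then 1 else 0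
  have hblock : ∀ k ≤ L,
      (if 𝒯.expParent^[k] e ∈ 𝒯.block x then (1 : ℂ) else 0) = a k + a (k + 1) := by
    intro k hk
    simp only [a, 𝒯.mem_block, Function.iterate_succ_apply']
    rcases hk.eq_or_lt with rfl | hk
    · have h0 : 𝒯.expParent^[L] e = none := 𝒯.expanded.iterate_level e
      simp [h0]
    · have h0 := 𝒯.iterate_ne_none e hk
      have hne : 𝒯.expParent^[k] e ≠ 𝒯.expParent (𝒯.expParent^[k] e) := by
        intro h
        have := 𝒯.level_eq_succ h0
        rw [← h] at this
        omega
      by_cases h1 : 𝒯.expParent^[k] e = x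
      · have h2 : 𝒯.expParent (𝒯.expParent^[k] e) ≠ x := fun h => hne (h1.trans h.symm)
        simp [h1, hk.le]
        rw [h1] at h2
        simp [h2]
      · simp [h1, h0, Nat.succ_le_iff.2 hk]
  have hterm : ∀ k ≤ L, 𝒯.psi D x (𝒯.expParent^[k] e) *
      ((-1) ^ k * ((1 / √(𝒯.weight D (𝒯.expParent^[k] e)) : ℝ) : ℂ)) =
      ((1 / √(𝒯.blockWeight D x) : ℝ) : ℂ) * ((-1) ^ k * a k - (-1) ^ (k + 1) * a (k + 1)) := by
    intro k hk
    have hw := (Real.sqrt_pos.2 (𝒯.weight_pos hD (𝒯.expParent^[k] e))).ne'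
    have : (-1) ^ k * a k - (-1) ^ (k + 1) * a (k + 1) = (-1) ^ k *
        (if 𝒯.expParent^[k] e ∈ 𝒯.block x then (1 : ℂ) else 0) := by
      rw [hblock k hk]; ring
    rw [this, psi_apply]
    split_ifs
    · rw [mul_left_comm, ← Complex.ofReal_mul, mul_one, mul_comm]
      congr 2
      field_simp
    · simp
  rw [star_psi, dotProduct]
  simp only [pathVector, mul_sum, mul_ite, mul_zero]
  rw [sum_comm]
  simp only [sum_ite_eq, mem_univ, if_true]
  -- The sum telescopes to `a 0 = 0`, as the path starts at `e ≠ x`.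
  rw [sum_congr rfl fun k hk => hterm k (Nat.lt_succ_iff.1 (mem_range.1 hk)), ← mul_sum,
    sum_range_sub' fun k => (-1) ^ k * a k]
  simp [a, hx.symm]

theorem walk_mulVec_pathVector {D : ℕ} (hD : 0 < D) {m : G} (hm : 𝒯.Marked m) :
    𝒯.walk D *ᵥ 𝒯.pathVector D (𝒯.endpoint m) = 𝒯.pathVector D (𝒯.endpoint m) := by
  have h : ∀ x, ¬ 𝒯.ExpMarked x →
      star (𝒯.psi D x) ⬝ᵥ 𝒯.pathVector D (𝒯.endpoint m) = 0 := fun x hx =>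
    𝒯.star_psi_dotProduct_pathVector hD fun h => hx ⟨m, hm, h⟩
  rw [walk_eq, ← mulVec_mulVec,
    𝒯.levelReflection_mulVec_of_orthogonal D _ fun x _ hx => h x hx,
    𝒯.levelReflection_mulVec_of_orthogonal D _ fun x _ hx => h x hx]

theorem card_path_le_depth [DecidableEq G] [DecidableLE G] (m : G) :
    (univ.filter fun v : G => v ≤ m ∧ v ≠ ⊥).card ≤ G.toParentTree.depth := by
  have hsub : (univ.filter fun v : G => v ≤ m ∧ v ≠ ⊥) ⊆
      (range (G.toParentTree.level m)).image fun k => Order.pred^[k] m := by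
    intro v hv
    obtain ⟨hle, hne⟩ := (mem_filter.1 hv).2
    obtain ⟨n, rfl⟩ := IsPredArchimedean.exists_pred_iterate_of_le hle
    refine mem_image.2 ⟨n, mem_range.2 ?_, rfl⟩
    by_contra! hn
    refine hne ?_
    have h0 : Order.pred^[G.toParentTree.level m] m = ⊥ := G.toParentTree.iterate_level m
    rw [← Nat.sub_add_cancel hn, Function.iterate_add_apply, h0]
    exact Function.iterate_fixed Order.pred_bot _
  refine (card_le_card hsub).trans (card_image_le.trans ?_)
  rw [card_range]
  exact le_sup (f := G.toParentTree.level) (mem_univ m)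

theorem sum_norm_sq_pathVector_le {D : ℕ} (hdepth : G.toParentTree.depth ≤ D)
    (m : G) : ∑ y, ‖𝒯.pathVector D (𝒯.endpoint m) y‖ ^ 2 ≤ 2 * D := by
  classical
  have hzero : ∀ y, (∀ k ≤ 𝒯.expanded.level (𝒯.endpoint m), 𝒯.expParent^[k] (𝒯.endpoint m) ≠ y) →
      𝒯.pathVector D (𝒯.endpoint m) y = 0 := fun y h =>
    sum_eq_zero fun k hk => if_neg (h k (Nat.lt_succ_iff.1 (mem_range.1 hk)))
  have hsome : ∀ (v : G) (i : Fin (𝒯.time v)),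
      ‖𝒯.pathVector D (𝒯.endpoint m) (some ⟨v, i⟩)‖ ^ 2 ≤
        if v ≤ m then 1 / (𝒯.time v : ℝ) else 0 := by
    intro v i
    by_cases h : ∃ k ≤ 𝒯.expanded.level (𝒯.endpoint m),
        𝒯.expParent^[k] (𝒯.endpoint m) = some ⟨v, i⟩
    · obtain ⟨k, hk, hv⟩ := h
      rw [if_pos (𝒯.le_of_iterate_eq m k v i hv), ← hv, 𝒯.pathVector_iterate D _ hk, hv]
      simp [weight]
    · push Not at h
      rw [hzero _ h]
      split_ifs <;> simp
  have hvertex : ∀ v : G, ∑ i : Fin (𝒯.time v),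
      ‖𝒯.pathVector D (𝒯.endpoint m) (some ⟨v, i⟩)‖ ^ 2 ≤ if v ≤ m ∧ v ≠ ⊥ then 1 else 0 := by
    intro v
    refine (sum_le_sum fun i _ => hsome v i).trans ?_
    by_cases hv : v = ⊥
    · subst hv
      simp [𝒯.time_root]
    · have : (𝒯.time v : ℝ) ≠ 0 := by exact_mod_cast (𝒯.time_pos v hv).ne'
      by_cases hle : v ≤ m <;> simp [hle, hv, this]
  rw [Fintype.sum_option, Fintype.sum_sigma, norm_sq_pathVector_none]
  have hcard : ((univ.filter fun v : G => v ≤ m ∧ v ≠ ⊥).card : ℝ) ≤ D := by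
    exact_mod_cast (card_path_le_depth m).trans hdepth
  have := sum_le_sum fun v (_ : v ∈ univ) => hvertex v
  rw [sum_boole] at this
  linarith

end ComputationTree

/-! ### Repeating a test -/

section Amplification

open Finset

variable {α : Type*} [Fintype α] [DecidableEq α]

/-- The generating function of the number of occurrences of `b` in `k` independent samples. -/
theorem sum_prod_mul_pow_card {q : α → ℝ} (hq : ∑ a, q a = 1) (b : α) (k : ℕ) (z : ℝ) :
    ∑ o : Fin k → α, (∏ i, q (o i)) * z ^ (univ.filter fun i => o i = b).card =
      (1 - q b + q b * z) ^ k := by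
  have hsum : ∑ a, q a * (if a = b then z else 1) = 1 - q b + q b * z := by
    rw [← add_sum_erase univ _ (mem_univ b)] at hq ⊢
    rw [sum_congr rfl fun a ha => by rw [if_neg (ne_of_mem_erase ha), mul_one], if_pos rfl]
    linarith
  rw [← hsum, ← Fin.prod_const, prod_univ_sum, Fintype.piFinset_univ]
  refine sum_congr rfl fun o _ => ?_
  rw [prod_mul_distrib, prod_ite, prod_const, prod_const_one, mul_one]

/-- Chernoff's bound for the number of occurrences of `b` in `k` independent samples. -/
theorem sum_prod_filter_le {q : α → ℝ} (hq0 : ∀ a, 0 ≤ q a) (hq : ∑ a, q a = 1) (b : α) (k : ℕ)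
    {z M : ℝ} (hz : 0 ≤ z) (hM : 0 ≤ M) (bad : (Fin k → α) → Prop) [DecidablePred bad]
    (hbad : ∀ o, bad o → 1 ≤ z ^ (univ.filter fun i => o i = b).card * M) :
    ∑ o ∈ univ.filter bad, ∏ i, q (o i) ≤ (1 - q b + q b * z) ^ k * M := by
  rw [← sum_prod_mul_pow_card hq, sum_mul]
  refine (sum_le_sum fun o ho => ?_).trans
    (sum_le_sum_of_subset_of_nonneg (filter_subset bad univ) fun o _ _ => ?_)
  · rw [mul_assoc]
    exact le_mul_of_one_le_right (prod_nonneg fun i _ => hq0 _) (hbad o (mem_filter.1 ho).2)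
  · have := prod_nonneg fun i (_ : i ∈ univ) => hq0 (o i)
    positivity

/-- Deciding by the threshold `3 / 8` whether an event has probability at least `1 / 2` or at most
`1 / 4` is correct with probability at least `2 / 3` for `40` samples. -/
theorem two_thirds_le_sum_prod {q : α → ℝ} (hq0 : ∀ a, 0 ≤ q a) (hq : ∑ a, q a = 1) (b : α)
    (A : Prop) (hyes : A → 1 / 2 ≤ q b) (hno : ¬ A → q b ≤ 1 / 4)
    (good : (Fin 40 → α) → Prop) [DecidablePred good]
    (hgood : ∀ o, good o ↔ (3 * 40 ≤ 8 * (univ.filter fun i => o i = b).card ↔ A)) :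
    2 / 3 ≤ ∑ o ∈ univ.filter good, ∏ i, q (o i) := by
  have htotal : ∑ o ∈ univ.filter good, ∏ i, q (o i) +
      ∑ o ∈ univ.filter (fun o => ¬ good o), ∏ i, q (o i) = 1 := by
    rw [sum_filter_add_sum_filter_not]
    simpa using sum_prod_mul_pow_card hq b 40 1
  have hb1 : q b ≤ 1 := hq ▸ single_le_sum (fun a _ => hq0 a) (mem_univ b)
  suffices h : ∑ o ∈ univ.filter (fun o => ¬ good o), ∏ i, q (o i) ≤ 1 / 3 by linarith
  by_cases hA : A
  · -- Fewer than 15 of the 40 samples are `b`, so that `2 ^ (-number) * 2 ^ 14` is at least `1`.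
    refine (sum_prod_filter_le hq0 hq b 40 (z := 1 / 2) (M := 2 ^ 14) (by norm_num) (by norm_num)
      _ fun o ho => ?_).trans ?_
    · simp only [hgood, hA, iff_true, not_le] at ho
      have hle : (univ.filter fun i => o i = b).card ≤ 14 := by omega
      calc (1 : ℝ) = (1 / 2) ^ 14 * 2 ^ 14 := by norm_num
        _ ≤ _ := by
          gcongr ?_ * _
          exact pow_le_pow_of_le_one (by norm_num) (by norm_num) hle
    · have := hyes hA
      calc _ ≤ (3 / 4 : ℝ) ^ 40 * 2 ^ 14 := by
            gcongr
            linarith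
        _ ≤ 1 / 3 := by norm_num
  · -- At least 15 of the 40 samples are `b`, so that `2 ^ number / 2 ^ 15` is at least `1`.
    refine (sum_prod_filter_le hq0 hq b 40 (z := 2) (M := (1 / 2) ^ 15) (by norm_num)
      (by norm_num) _ fun o ho => ?_).trans ?_
    · simp only [hgood, hA, iff_false, not_not] at ho
      have hle : 15 ≤ (univ.filter fun i => o i = b).card := by omega
      calc (1 : ℝ) = 2 ^ 15 * (1 / 2) ^ 15 := by norm_num
        _ ≤ _ := by
          gcongr ?_ * _
          exact pow_le_pow_right₀ (by norm_num) hle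
    · have := hno hA
      have := hq0 b
      calc _ ≤ (5 / 4 : ℝ) ^ 40 * (1 / 2) ^ 15 := by
            gcongr
            linarith
        _ ≤ 1 / 3 := by norm_num

end Amplification

/-! ### The detection algorithm -/

namespace ComputationTree

open PhaseEstimation

variable {G : RootedTree} [Fintype G] (𝒯 : ComputationTree G)

theorem half_le_acceptProb {D : ℕ} (hD : 0 < D) (hdepth : G.toParentTree.depth ≤ D) (ε : ℝ)
    (hm : ∃ v, 𝒯.Marked v) : 1 / 2 ≤ 𝒯.acceptProb D ε := by
  classical
  obtain ⟨m, hm⟩ := hm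
  have h := norm_sq_le_mul_outcomeProb_zero (𝒯.walk_mem_unitaryGroup hD) none ε _
    (𝒯.walk_mulVec_pathVector hD hm)
  rw [norm_sq_pathVector_none] at h
  have h2 := h.trans (mul_le_mul_of_nonneg_right (𝒯.sum_norm_sq_pathVector_le hdepth m)
    (outcomeProb_nonneg _ _ _ _))
  have hD' : (0 : ℝ) < D := by positivity
  rw [acceptProb]
  nlinarith

theorem acceptProb_le {D : ℕ} (hD : 0 < D) (hdepth : 0 < G.toParentTree.depth) {ε : ℝ}
    (hε : ε = 1 / √((𝒯.sqTime : ℝ) * D)) (hm : ¬ ∃ v, 𝒯.Marked v) :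
    𝒯.acceptProb D ε ≤ 1 / 4 := by
  classical
  have h := outcomeProb_zero_le (𝒯.walk_mem_unitaryGroup hD) none ε _
    (𝒯.walk_mulVec_sqrt_weight hD hm)
  rw [𝒯.sum_norm_sq_sqrt_weight hD] at h
  refine h.trans ?_
  have hTD : 1 ≤ (𝒯.sqTime : ℝ) * D := by
    exact_mod_cast Nat.mul_pos (𝒯.one_le_sqTime hdepth) hD
  have hN : 8 * √((𝒯.sqTime : ℝ) * D) ≤ 2 ^ qubits ε := by
    simpa [hε] using le_two_pow_qubits (ε := ε)
  have hN2 := pow_le_pow_left₀ (by positivity) hN 2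
  rw [mul_pow, Real.sq_sqrt (by positivity)] at hN2
  rw [div_le_iff₀ (by positivity)]
  linarith

end ComputationTree

theorem theorem1 :
    ∃ (c C : ℝ) (k : ℕ), 0 < c ∧
      ∀ (G : RootedTree) [Fintype G] [DecidableEq G] (𝒯 : ComputationTree G) (D : ℕ),
        0 < G.toParentTree.depth → G.toParentTree.depth ≤ D →
        ∀ ε : ℝ, ε = c / √((𝒯.sqTime : ℝ) * D) →
          -- the step of the walk is a unitary operator
          𝒯.walk D ∈ Matrix.unitaryGroup 𝒯.ExpVertex ℂ ∧
          -- a single run of phase estimation separates the two cases by a constant gap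
          ((∃ v, 𝒯.Marked v) → 1 / 2 ≤ 𝒯.acceptProb D ε) ∧
          ((¬ ∃ v, 𝒯.Marked v) → 𝒯.acceptProb D ε ≤ 1 / 4) ∧
          -- after a constant number of runs, the answer is correct with probability at least 2/3
          2 / 3 ≤ 𝒯.successProb D ε k ∧
          -- the total number of applications of the step in these runs
          ((k * PhaseEstimation.uses
              (PhaseEstimation.circuit (PhaseEstimation.qubits ε)) : ℕ) : ℝ) ≤
            C * √((𝒯.sqTime : ℝ) * D) := by
  refine ⟨1, 40 * 32, 40, one_pos, fun G _ _ 𝒯 D hdepth hD ε hε => ?_⟩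
  have hD0 : 0 < D := hdepth.trans_le hD
  have hU : 𝒯.walk D ∈ Matrix.unitaryGroup 𝒯.ExpVertex ℂ := 𝒯.walk_mem_unitaryGroup hD0
  have hyes := 𝒯.half_le_acceptProb hD0 hD ε
  have hno := 𝒯.acceptProb_le hD0 hdepth hε
  refine ⟨hU, hyes, hno, ?_, ?_⟩
  · classical
    refine two_thirds_le_sum_prod (PhaseEstimation.outcomeProb_nonneg _ _ _)
      (PhaseEstimation.sum_outcomeProb hU none ε) (fun _ => false) _ hyes hno _ fun o => ?_
    rw [ComputationTree.AnswersYes]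
  · have hTD : 1 ≤ (𝒯.sqTime : ℝ) * D := by
      exact_mod_cast Nat.mul_pos (𝒯.one_le_sqTime hdepth) hD0
    have hsqrt : 1 ≤ √((𝒯.sqTime : ℝ) * D) := Real.one_le_sqrt.2 hTD
    have hN : (2 : ℝ) ^ PhaseEstimation.qubits ε ≤ 32 * √((𝒯.sqTime : ℝ) * D) := by
      have h := PhaseEstimation.two_pow_qubits_le (ε := ε) (by rw [hε]; positivity)
        (by rw [hε]; exact div_le_one_of_le₀ hsqrt (by positivity))
      simpa [hε] using h
    have huses : (PhaseEstimation.uses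
        (PhaseEstimation.circuit (PhaseEstimation.qubits ε)) : ℝ) ≤
          2 ^ PhaseEstimation.qubits ε := by
      exact_mod_cast PhaseEstimation.uses_circuit_le _
    push_cast
    linarith
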